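/- Let $K/\mathbb{Q}$ be a number field and let $\mathfrak{p}$ be a prime of $K$ of degree one with residue characteristic $p$, meaning that $K_{\mathfrak p}=\mathbb{Q}_p$ (i.e. $\mathfrak p$ has residue degree $1$ and ramification index $1$ over $p$). Let $\mathcal{O}_{K,\mathfrak p}$ be the localization of $\mathcal{O}_K$ at $\mathfrak p$. Let $X\subset\mathbb{P}^n_K$ be a projective variety (a closed subscheme) and let $\phi:X\to X$ be a finite $K$-morphism. Let $\mathcal{X}\subset\mathbb{P}^n_{\mathcal{O}_{K,\mathfrak p}}$ be a closed subscheme with generic fiber $X\subset\mathbb{P}^n_K$, and suppose that $\phi$ extends to a finite $\mathcal{O}_{K,\mathfrak p}$-morphism $\Phi:\mathcal{X}\to\mathcal{X}$ whose restriction $\widetilde\Phi:\widetilde{\mathcal X}\to\widetilde{\mathcal X}$ to the special fiber factors through the relative Frobenius map $\mathrm{Frob}:\widetilde{\mathcal X}\to\widetilde{\mathcal X}^{(p)}$. Let $L/K$ be a finite abelian extension that is ramified at $\mathfrak p$, let $\mathfrak P$ be a prime of $L$ lying over $\mathfrak p$, and let $\mathcal{O}_{L,\mathfrak P}$ be the localization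 of $\mathcal{O}_L$ at $\mathfrak P$. Let $\tau\neq 1$ be an element of the inertia group of $\mathfrak P$ in $\mathrm{Gal}(L/K)$ such that $$\tau(\alpha)^p\equiv\alpha^p \pmod{p\,\mathcal{O}_{L,\mathfrak P}}\qquad\text{for all }\alpha\in\mathcal{O}_{L,\mathfrak P}.$$ For $x,y\in\mathbb{P}^n(L)$ with homogeneous coordinates $[x_0,\dots,x_n]$ and $[y_0,\dots,y_n]$, let $$\delta_{\mathfrak P}(x,y)=-\log\frac{\max_{i,j}|x_iy_j-x_jy_i|_{\mathfrak P}}{\max_k|x_k|_{\mathfrak P}\cdot\max_k|y_k|_{\mathfrak P}},\qquad \delta_{\mathfrak P}(x,x)=\infty,$$ where $|\cdot|_{\mathfrak P}$ is the $\mathfrak P$-adic absolute value on $L$ that extends the standard $p$-adic absolute value on $\mathbb{Q}$ (so $|p|_{\mathfrak P}=1/p$). Then for all points $P\in X(L)$, $$\delta_{\mathfrak P}\bigl(\phi(\tau(P)),\phi(P)\bigr)\ge\log p.$$ -/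

import Mathlib

open CategoryTheory Limits AlgebraicGeometry NumberField IsDedekindDomain

universe u

noncomputable section

namespace RamDist

/-! ### Local rings and normalized absolute values of number fields -/

section Local

variable (F : Type u) [Field F] [NumberField F] (v : HeightOneSpectrum (𝓞 F))

/-- The localization of `𝓞 F` at the prime `v`, as a subring of `F`. -/
abbrev localRing : Subalgebra (𝓞 F) F :=
  Localization.subalgebra.ofField F v.asIdeal.primeCompl v.asIdeal.primeCompl_le_nonZeroDivisors

instance : IsLocalization.AtPrime (localRing F v) v.asIdeal :=
  Localization.subalgebra.isLocalization_ofField F _ _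

instance : IsLocalRing (localRing F v) :=
  IsLocalization.AtPrime.isLocalRing (localRing F v) v.asIdeal

/-- The residue field of the localization of `𝓞 F` at `v`. -/
abbrev localResidue : Type u := IsLocalRing.ResidueField (localRing F v)

/-- The local degree `[F_v : ℚ_p]`, as the product of the absolute ramification index and the
absolute residue degree. -/
def localDegree : ℕ := v.asIdeal.ramificationIdx ℤ * v.asIdeal.inertiaDeg ℤ

/-- The `v`-adic absolute value on `F` extending the standard `p`-adic absolute value of `ℚ`:
the value `N(v) ^ (- ord_v x)`, raised to the power `1 / [F_v : ℚ_p]`. -/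
def placeAbs (x : F) : ℝ := (HeightOneSpectrum.adicAbv F v x) ^ (1 / (localDegree F v : ℝ))

/-- The logarithmic `v`-adic distance between the points of projective space with homogeneous
coordinates `x` and `y`; it is `⊤` if the two points coincide. -/
def logDist {n : ℕ} (x y : Fin (n + 1) → F) : EReal :=
  let r : ℝ := (⨆ ij : Fin (n + 1) × Fin (n + 1),
      placeAbs F v (x ij.1 * y ij.2 - x ij.2 * y ij.1)) /
    ((⨆ k, placeAbs F v (x k)) * (⨆ k, placeAbs F v (y k)))
  if r = 0 then ⊤ else ((-Real.log r : ℝ) : EReal)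

end Local

/-! ### Projective space -/

section ProjectiveSpace

/-- The grading by degree on `ℤ[X_0, …, X_n]` (with a universe lift). -/
abbrev grading (n : ℕ) : ℕ → Submodule (ULift.{u} ℤ) (MvPolynomial (Fin (n + 1)) (ULift.{u} ℤ)) :=
  MvPolynomial.homogeneousSubmodule (Fin (n + 1)) (ULift.{u} ℤ)

instance (n : ℕ) : GradedRing (grading.{u} n) :=
  MvPolynomial.gradedAlgebra

lemma X_mem_grading {n : ℕ} (i : Fin (n + 1)) : MvPolynomial.X i ∈ grading.{u} n 1 :=
  MvPolynomial.isHomogeneous_X _ i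

/-- Projective `n`-space over `ℤ`. -/
abbrev ProjZ (n : ℕ) : Scheme.{u} := Proj (grading.{u} n)

/-- Projective `n`-space over a base scheme `S`. -/
abbrev PSpace (n : ℕ) (S : Scheme.{u}) : Scheme.{u} :=
  pullback (terminal.from S) (terminal.from (ProjZ.{u} n))

/-- The structure morphism of projective space. -/
abbrev PSpace.toBase (n : ℕ) (S : Scheme.{u}) : PSpace n S ⟶ S := pullback.fst _ _

/-- The projection from projective space over `S` to projective space over `ℤ`. -/
abbrev PSpace.toProjZ (n : ℕ) (S : Scheme.{u}) : PSpace n S ⟶ ProjZ.{u} n := pullback.snd _ _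

/-- The base change morphism between projective spaces. -/
def PSpace.map (n : ℕ) {S T : Scheme.{u}} (f : S ⟶ T) : PSpace n S ⟶ PSpace n T :=
  pullback.lift (PSpace.toBase n S ≫ f) (PSpace.toProjZ n S) (Subsingleton.elim _ _)

/-- The standard affine chart `X_i ≠ 0`. -/
def chart {n : ℕ} (i : Fin (n + 1)) : (ProjZ.{u} n).Opens :=
  Proj.basicOpen (grading.{u} n) (MvPolynomial.X i)

lemma iSup_chart (n : ℕ) : ⨆ i : Fin (n + 1), chart.{u} i = ⊤ := by
  refine Proj.iSup_basicOpen_eq_top' (grading.{u} n) (fun i => MvPolynomial.X i)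
    (fun i => ⟨1, X_mem_grading i⟩) ?_
  refine top_le_iff.mp fun x _ => ?_
  induction x using MvPolynomial.induction_on with
  | C a =>
    exact Subalgebra.algebraMap_mem (Algebra.adjoin _ _)
      (⟨MvPolynomial.C a, MvPolynomial.isHomogeneous_C _ a⟩ : grading.{u} n 0)
  | add p q hp hq => exact add_mem (hp trivial) (hq trivial)
  | mul_X p i hp => exact mul_mem (hp trivial) (Algebra.subset_adjoin ⟨i, rfl⟩)

/-- The regular function `X_j / X_i` on the chart `X_i ≠ 0`. -/
def ratio {n : ℕ} (i j : Fin (n + 1)) : Γ(ProjZ.{u} n, chart i) :=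
  Proj.awayToSection (grading.{u} n) (MvPolynomial.X i)
    (HomogeneousLocalization.Away.mk (grading.{u} n) (X_mem_grading i) 1
      (MvPolynomial.X j) (by rw [one_smul]; exact X_mem_grading j))

variable {n : ℕ} {L : Type u} [Field L]

/-- Every field-valued point of projective space lies in a standard chart. -/
lemma exists_chart (Q : Spec (.of L) ⟶ ProjZ.{u} n) : ∃ i : Fin (n + 1), ⊤ ≤ Q ⁻¹ᵁ chart i := by
  obtain ⟨i, hi⟩ := TopologicalSpace.Opens.mem_iSup.mp
    ((iSup_chart.{u} n).ge (Set.mem_univ (Q (IsLocalRing.closedPoint L))))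
  refine ⟨i, fun x _ => ?_⟩
  have : x = IsLocalRing.closedPoint L := Subsingleton.elim (α := PrimeSpectrum L) _ _
  subst this
  exact hi

/-- The value of `X_j / X_i` at a field-valued point of the chart `X_i ≠ 0`. -/
def chartCoord (Q : Spec (.of L) ⟶ ProjZ.{u} n) (i : Fin (n + 1)) (hi : ⊤ ≤ Q ⁻¹ᵁ chart i)
    (j : Fin (n + 1)) : L :=
  (Scheme.ΓSpecIso (.of L)).hom (Q.appLE (chart i) ⊤ hi (ratio i j))

/-- Homogeneous coordinates of a field-valued point: its coordinates `X_j / X_i` in some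
standard chart `X_i ≠ 0` that contains it. -/
def homCoords (Q : Spec (.of L) ⟶ ProjZ.{u} n) : Fin (n + 1) → L :=
  chartCoord Q (exists_chart Q).choose (exists_chart Q).choose_spec

end ProjectiveSpace

/-! ### The Frobenius morphism in characteristic `p` -/

section Frobenius

variable (p : ℕ)

/-- The `p`-th power map of a commutative ring in which `p = 0`. -/
def powHom [hp : Fact p.Prime] (R : Type u) [CommRing R] (h : (p : R) = 0) : R →+* R where
  toFun x := x ^ p
  map_one' := one_pow p
  map_mul' x y := mul_pow x y p
  map_zero' := zero_pow hp.out.ne_zero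
  map_add' x y := by
    obtain ⟨r, hr⟩ := exists_add_pow_prime_eq hp.out x y
    simp [hr, h]

/-- A scheme has characteristic `p` if `p = 0` in its ring of global functions. -/
def HasChar (X : Scheme.{u}) : Prop := (p : Γ(X, ⊤)) = 0

variable {p}

lemma HasChar.section_eq_zero {X : Scheme.{u}} (h : HasChar p X) (U : X.Opens) :
    (p : Γ(X, U)) = 0 := by
  have := congrArg (X.presheaf.map (homOfLE (le_top : U ≤ ⊤)).op) h
  simpa using this

lemma HasChar.of_hom {X Y : Scheme.{u}} (f : X ⟶ Y) (h : HasChar p Y) : HasChar p X := by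
  have := congrArg f.appTop h
  simpa [HasChar] using this

lemma hasChar_Spec {R : Type u} [CommRing R] (h : (p : R) = 0) : HasChar p (Spec (.of R)) := by
  have := congrArg (Scheme.ΓSpecIso (.of R)).inv h
  simpa [HasChar] using this

variable [hp : Fact p.Prime]

/-- The absolute Frobenius as a morphism of presheafed spaces. -/
def absFrobPre {X : Scheme.{u}} (h : HasChar p X) :
    X.toPresheafedSpace ⟶ X.toPresheafedSpace where
  base := 𝟙 _
  c :=
    { app := fun U => CommRingCat.ofHom (powHom p Γ(X, U.unop) (h.section_eq_zero U.unop))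
      naturality := fun U V f => by
        ext x
        exact (map_pow (X.presheaf.map f).hom x p).symm }

lemma absFrobPre_stalkMap {X : Scheme.{u}} (h : HasChar p X) (x : X)
    (s : X.presheaf.stalk x) :
    (PresheafedSpace.Hom.stalkMap (absFrobPre h) x).hom s = s ^ p := by
  obtain ⟨U, hx, t, rfl⟩ := X.presheaf.exists_germ_eq s
  have := PresheafedSpace.stalkMap_germ_apply (absFrobPre h) U x hx t
  refine this.trans ?_
  exact map_pow (X.presheaf.germ U x hx).hom t p

/-- The absolute Frobenius of a scheme of characteristic `p`: the identity on points and the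
`p`-th power map on functions. -/
def absFrob {X : Scheme.{u}} (h : HasChar p X) : X ⟶ X where
  __ := absFrobPre h
  prop x := ⟨fun s hs => by
    have h1 := (congrArg IsUnit (absFrobPre_stalkMap h x s)).mp hs
    exact (isUnit_pow_iff hp.out.ne_zero).mp h1⟩

lemma absFrob_naturality {X S : Scheme.{u}} (f : X ⟶ S) (hX : HasChar p X) (hS : HasChar p S) :
    absFrob hX ≫ f = f ≫ absFrob hS := by
  refine Scheme.Hom.ext rfl fun U => ?_
  ext x
  have h : (X.presheaf.map (eqToHom rfl).op).hom ((f.app U).hom x ^ p) =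
      (f.app U).hom (x ^ p) := by
    simp
  exact h

/-- The Frobenius twist `X^(p)` of an `S`-scheme `X`: its base change along the absolute
Frobenius of `S`. -/
abbrev frobTwist {X S : Scheme.{u}} (f : X ⟶ S) (hS : HasChar p S) : Scheme.{u} :=
  pullback f (absFrob hS)

/-- The relative Frobenius `X ⟶ X^(p)` of an `S`-scheme `X`. -/
def relFrob {X S : Scheme.{u}} (f : X ⟶ S) (hS : HasChar p S) : X ⟶ frobTwist f hS :=
  pullback.lift (absFrob (hS.of_hom f)) f (absFrob_naturality f _ hS)

/-- The endomorphism `g` of the `S`-scheme `X` factors through the relative Frobenius. -/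
def FactorsThroughFrob {X S : Scheme.{u}} (f : X ⟶ S) (hS : HasChar p S) (g : X ⟶ X) : Prop :=
  ∃ ψ : frobTwist f hS ⟶ X, g = relFrob f hS ≫ ψ

end Frobenius

/-! ### Special fibers and reductions -/

section SpecialFiber

variable {K : Type u} [Field K] [NumberField K] (v : HeightOneSpectrum (𝓞 K))

/-- The inclusion of the generic point `Spec K ⟶ Spec 𝓞_{K,v}`. -/
abbrev genericPt : Spec (.of K) ⟶ Spec (.of (localRing K v)) :=
  Spec.map (CommRingCat.ofHom (algebraMap (localRing K v) K))

/-- The inclusion of the closed point `Spec k_v ⟶ Spec 𝓞_{K,v}`. -/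
abbrev closedPt : Spec (.of (localResidue K v)) ⟶ Spec (.of (localRing K v)) :=
  Spec.map (CommRingCat.ofHom (IsLocalRing.residue (localRing K v)))

/-- The residue field at a prime containing `p` has characteristic `p`. -/
lemma hasChar_residue {p : ℕ} (hp : (p : 𝓞 K) ∈ v.asIdeal) :
    HasChar p (Spec (.of (localResidue K v))) := by
  refine hasChar_Spec ?_
  have h := (IsLocalization.AtPrime.to_map_mem_maximal_iff (localRing K v) v.asIdeal
    (p : 𝓞 K)).mpr hp
  rw [← IsLocalRing.residue_eq_zero_iff] at h
  simpa using h

variable {v} {Y : Scheme.{u}}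

/-- The special fiber of a scheme over `𝓞_{K,v}`. -/
abbrev specialFiber (f : Y ⟶ Spec (.of (localRing K v))) : Scheme.{u} :=
  pullback f (closedPt v)

/-- The structure morphism of the special fiber over the residue field. -/
abbrev specialFiberToBase (f : Y ⟶ Spec (.of (localRing K v))) :
    specialFiber f ⟶ Spec (.of (localResidue K v)) :=
  pullback.snd f (closedPt v)

/-- The restriction to the special fiber of an endomorphism over `𝓞_{K,v}`. -/
def reduction (f : Y ⟶ Spec (.of (localRing K v))) (Φ : Y ⟶ Y) (hΦ : Φ ≫ f = f) :
    specialFiber f ⟶ specialFiber f :=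
  pullback.lift (pullback.fst f (closedPt v) ≫ Φ) (specialFiberToBase f)
    (by rw [Category.assoc, hΦ, pullback.condition])

end SpecialFiber

end RamDist

end

noncomputable section

namespace RamDist

/-! Write $A=\mathcal{O}_{L,\mathfrak P}$. Since the model is proper, $P$ extends to an $A$-point
`l` of it, and $\tau(P)$ extends to the composite of `l` with the map `σ` that $\tau$ induces on
$\mathrm{Spec}\,A$. Over $R=A/pA$ the hypothesis on $\tau$ says that these two points agree after
composition with the Frobenius of $R$ (`absFrob_comp_Spec_map`).

Since $\mathfrak p$ is unramified over $p$, its maximal ideal is generated by $p$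
(`maximalIdeal_eq_span`), so both $R$-points lie in the special fiber. There $\Phi$ factors through
the relative Frobenius, which sees a point only through its Frobenius composite and its structure
map. Hence $\Phi$ sends both points to the same $R$-point (`comp_eq_of_factorsThroughFrob`).

So $\phi(\tau(P))$ and $\phi(P)$ extend to $A$-points that coincide modulo $p$. In a common chart
their coordinates are congruent modulo $p$, and every $2\times 2$ minor is divisible by $p$
(`log_le_logDist_of_congr`). -/

lemma liesOver_span_of_natCast_mem {R : Type*} [CommRing R] (I : Ideal R) [I.IsPrime] {p : ℕ}
    [Fact p.Prime] (hp : (p : R) ∈ I) : I.LiesOver (Ideal.span {(p : ℤ)}) := by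
  refine ⟨Ideal.IsMaximal.eq_of_le ?_ ?_ ?_⟩
  · exact Int.ideal_span_isMaximal_of_prime p
  · exact Ideal.IsPrime.ne_top (Ideal.IsPrime.under ℤ I)
  · rw [Ideal.span_singleton_le_iff_mem, Ideal.mem_comap]
    simpa using hp

/-! ### Local rings, normalized absolute values and the distance estimate -/

section Local

variable {F : Type u} [Field F] [NumberField F] (v : HeightOneSpectrum (𝓞 F))

lemma mem_localRing_iff {x : F} :
    x ∈ localRing F v ↔ ∃ a s : 𝓞 F, s ∉ v.asIdeal ∧
      x = algebraMap (𝓞 F) F a * (algebraMap (𝓞 F) F s)⁻¹ := by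
  constructor
  · rintro ⟨a, s, hs, rfl⟩
    exact ⟨a, s, hs, rfl⟩
  · rintro ⟨a, s, hs, rfl⟩
    exact ⟨a, s, hs, rfl⟩

instance : IsDiscreteValuationRing (localRing F v) :=
  IsLocalization.AtPrime.isDiscreteValuationRing_of_dedekind_domain (𝓞 F) v.ne_bot _

instance : IsFractionRing (localRing F v) F :=
  Localization.subalgebra.isFractionRing_ofField F _ _

lemma placeAbs_nonneg (x : F) : 0 ≤ placeAbs F v x :=
  Real.rpow_nonneg ((HeightOneSpectrum.adicAbv F v).nonneg x) _

lemma placeAbs_mul (x y : F) : placeAbs F v (x * y) = placeAbs F v x * placeAbs F v y := by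
  rw [placeAbs, map_mul, Real.mul_rpow (AbsoluteValue.nonneg _ _) (AbsoluteValue.nonneg _ _)]
  rfl

lemma placeAbs_pos {x : F} (hx : x ≠ 0) : 0 < placeAbs F v x :=
  Real.rpow_pos_of_pos ((HeightOneSpectrum.adicAbv F v).pos hx) _

lemma placeAbs_le_one {x : F} (hx : x ∈ localRing F v) : placeAbs F v x ≤ 1 := by
  obtain ⟨a, s, hs, rfl⟩ := (mem_localRing_iff v).mp hx
  refine Real.rpow_le_one (AbsoluteValue.nonneg _ _) ?_ (by positivity)
  have h1 : HeightOneSpectrum.adicAbv F v (algebraMap (𝓞 F) F s) = 1 :=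
    (v.adicAbv_coe_eq_one_iff (HeightOneSpectrum.one_lt_absNorm_nnreal v) s).mpr hs
  rw [map_mul, map_inv₀, h1, inv_one, mul_one]
  exact v.adicAbv_coe_le_one (HeightOneSpectrum.one_lt_absNorm_nnreal v) a

variable {p : ℕ}

lemma prime_mem_maximalIdeal (hp : (p : 𝓞 F) ∈ v.asIdeal) :
    (p : localRing F v) ∈ IsLocalRing.maximalIdeal (localRing F v) := by
  simpa using (IsLocalization.AtPrime.to_map_mem_maximal_iff (localRing F v) v.asIdeal
      (p : 𝓞 F)).mpr hp

variable [Fact p.Prime]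

lemma intValuation_prime (hp : (p : 𝓞 F) ∈ v.asIdeal) :
    v.intValuation (p : 𝓞 F) = WithZero.exp (-(v.asIdeal.ramificationIdx ℤ : ℤ)) := by
  have := liesOver_span_of_natCast_mem v.asIdeal hp
  have h0 : (p : 𝓞 F) ≠ 0 := by exact_mod_cast (Fact.out : p.Prime).ne_zero
  have hs : Ideal.map (algebraMap ℤ (𝓞 F)) (Ideal.span {(p : ℤ)}) = Ideal.span {(p : 𝓞 F)} := by
    simp [Ideal.map_span]
  rw [HeightOneSpectrum.intValuation_eq_exp_neg_multiplicity v h0,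
    Ideal.IsDedekindDomain.ramificationIdx_eq_multiplicity (Ideal.span {(p : ℤ)}), hs]
  rw [hs]
  simpa using h0

lemma absNorm_eq (hp : (p : 𝓞 F) ∈ v.asIdeal) :
    Ideal.absNorm v.asIdeal = p ^ v.asIdeal.inertiaDeg ℤ := by
  have := liesOver_span_of_natCast_mem v.asIdeal hp
  rw [← Ideal.absNorm_pow_inertiaDeg (Ideal.span {(p : ℤ)}) v.asIdeal]
  simp

/-- With $e$ and $f$ the ramification index and residue degree, $N(v)^{-e}=p^{-ef}$, and the
exponent $1/(ef)$ in `placeAbs` undoes the power. -/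
lemma placeAbs_prime (hp : (p : 𝓞 F) ∈ v.asIdeal) : placeAbs F v (p : F) = (p : ℝ)⁻¹ := by
  have hpp : p.Prime := Fact.out
  have hadic : HeightOneSpectrum.adicAbv F v (p : F) = ((p : ℝ)⁻¹) ^ localDegree F v := by
    have h : v.valuation F (p : F) = WithZero.exp (-(v.asIdeal.ramificationIdx ℤ : ℤ)) := by
      rw [← intValuation_prime v hp, ← HeightOneSpectrum.valuation_of_algebraMap (K := F)]
      simp
    rw [HeightOneSpectrum.adicAbv_def, h,
      WithZeroMulInt.toNNReal_neg_apply _ WithZero.exp_ne_zero, absNorm_eq v hp]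
    have hu : (WithZero.unzero (WithZero.exp_ne_zero (M := ℤ)
        (a := -(v.asIdeal.ramificationIdx ℤ : ℤ)))).toAdd = -(v.asIdeal.ramificationIdx ℤ : ℤ) := rfl
    rw [hu]
    simp [localDegree, ← pow_mul, mul_comm]
  have hd : localDegree F v ≠ 0 := by
    exact mul_ne_zero (Ideal.ramificationIdx_pos _ _).ne' (Ideal.inertiaDeg_pos _ _).ne'
  rw [placeAbs, hadic, one_div, Real.pow_rpow_inv_natCast (by positivity) hd]

/-- Ramification index $1$ keeps $p$ out of the square of the maximal ideal, so the cofactor of a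
uniformizer in $p$ is a unit. -/
lemma maximalIdeal_eq_span (hp : (p : 𝓞 F) ∈ v.asIdeal) (hdeg : localDegree F v = 1) :
    IsLocalRing.maximalIdeal (localRing F v) = Ideal.span {(p : localRing F v)} := by
  have he : v.asIdeal.ramificationIdx ℤ = 1 := Nat.eq_one_of_mul_eq_one_right hdeg
  have hp0 := prime_mem_maximalIdeal v hp
  have hp1 : (p : localRing F v) ∉ IsLocalRing.maximalIdeal (localRing F v) ^ 2 := by
    intro h
    have h2 : algebraMap (𝓞 F) (localRing F v) (p : 𝓞 F) ∈
        (v.asIdeal ^ 2).map (algebraMap (𝓞 F) (localRing F v)) := by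
      rw [Ideal.map_pow, IsLocalization.AtPrime.map_eq_maximalIdeal v.asIdeal (localRing F v)]
      simpa using h
    rw [IsLocalization.algebraMap_mem_map_algebraMap_iff v.asIdeal.primeCompl] at h2
    obtain ⟨s, hs, hsp⟩ := h2
    rw [← HeightOneSpectrum.intValuation_le_pow_iff_mem, map_mul, intValuation_prime v hp, he,
      (HeightOneSpectrum.intValuation_eq_one_iff_mem_primeCompl v s).mpr hs, one_mul,
      WithZero.exp_le_exp] at hsp
    norm_num at hsp
  obtain ⟨ϖ, hϖ⟩ := IsDiscreteValuationRing.exists_irreducible (localRing F v)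
  rw [hϖ.maximalIdeal_eq] at hp0 hp1 ⊢
  obtain ⟨c, hc⟩ := Ideal.mem_span_singleton.mp hp0
  have hcu : IsUnit c := by
    by_contra hcn
    have : c ∈ Ideal.span {ϖ} := by
      rw [← hϖ.maximalIdeal_eq]; exact hcn
    apply hp1
    rw [hc, sq]
    exact Ideal.mul_mem_mul (Ideal.mem_span_singleton_self _) this
  rw [hc]
  exact (Ideal.span_singleton_mul_right_unit hcu ϖ).symm

/-- Points with congruent integral coordinates modulo `p` are at logarithmic distance at least
`log p`. -/
lemma log_le_logDist {n : ℕ} (hp : (p : 𝓞 F) ∈ v.asIdeal) {x y a b : Fin (n + 1) → F} {c d : F}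
    (hc : c ≠ 0) (hd : d ≠ 0) (hx : ∀ j, x j = c * a j) (hy : ∀ j, y j = d * b j)
    (ha : ∀ j, a j ∈ localRing F v)
    (hab : ∀ j, ∃ t ∈ localRing F v, a j - b j = p * t)
    {i : Fin (n + 1)} (hai : a i = 1) (hbi : b i = 1) :
    ((Real.log p : ℝ) : EReal) ≤ logDist F v x y := by
  have hpp : 0 < (p : ℝ) := by exact_mod_cast (Fact.out : p.Prime).pos
  have hC := placeAbs_pos v hc
  have hD := placeAbs_pos v hd
  have hxm : placeAbs F v c ≤ ⨆ k, placeAbs F v (x k) := by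
    refine le_trans (le_of_eq ?_) (le_ciSup (Set.finite_range _).bddAbove i)
    rw [hx, hai, mul_one]
  have hym : placeAbs F v d ≤ ⨆ k, placeAbs F v (y k) := by
    refine le_trans (le_of_eq ?_) (le_ciSup (Set.finite_range _).bddAbove i)
    rw [hy, hbi, mul_one]
  have hnum : (⨆ ij : Fin (n + 1) × Fin (n + 1),
      placeAbs F v (x ij.1 * y ij.2 - x ij.2 * y ij.1)) ≤
      (p : ℝ)⁻¹ * (placeAbs F v c * placeAbs F v d) := by
    refine ciSup_le fun ⟨k, l⟩ => ?_
    obtain ⟨s, hs, hsk⟩ := hab k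
    obtain ⟨t, ht, htl⟩ := hab l
    -- Replacing $b$ by $a$ minus a multiple of $p$ cancels the terms $a_ka_l$ of the minor and
    -- leaves a factor $p$.
    have : x k * y l - x l * y k = p * (c * d) * (a l * s - a k * t) := by
      rw [hx, hx, hy, hy, show b k = a k - p * s by rw [← hsk]; ring,
        show b l = a l - p * t by rw [← htl]; ring]
      ring
    simp only [this]
    rw [placeAbs_mul, placeAbs_mul, placeAbs_mul, placeAbs_prime v hp]
    exact mul_le_of_le_one_right (by positivity)
      (placeAbs_le_one v (sub_mem (mul_mem (ha l) hs) (mul_mem (ha k) ht)))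
  have hnum0 : 0 ≤ ⨆ ij : Fin (n + 1) × Fin (n + 1),
      placeAbs F v (x ij.1 * y ij.2 - x ij.2 * y ij.1) :=
    Real.iSup_nonneg fun _ => placeAbs_nonneg v _
  simp only [logDist]
  split_ifs with h
  · exact le_top
  · rw [EReal.coe_le_coe_iff]
    have hden : placeAbs F v c * placeAbs F v d ≤
        (⨆ k, placeAbs F v (x k)) * (⨆ k, placeAbs F v (y k)) :=
      mul_le_mul hxm hym hD.le (hC.le.trans hxm)
    have hden0 := (mul_pos hC hD).trans_le hden
    rw [le_neg, ← Real.log_inv]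
    refine Real.log_le_log (lt_of_le_of_ne (div_nonneg hnum0 hden0.le) (Ne.symm h)) ?_
    rw [div_le_iff₀ hden0]
    exact hnum.trans (mul_le_mul_of_nonneg_left hden (by positivity))

end Local

/-! ### Inertia and field extensions acting on local rings -/

section Galois

variable {K L : Type u} [Field K] [Field L] [NumberField L] [Algebra K L]
  {𝔓 : HeightOneSpectrum (𝓞 L)}

/-- Inertia moves $s$ only by an element of $\mathfrak P$, so denominators prime to $\mathfrak P$
stay prime to it. -/
lemma map_mem_localRing {τ : L ≃ₐ[K] L} (hτ : τ ∈ 𝔓.asIdeal.inertia (L ≃ₐ[K] L)) {x : L}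
    (hx : x ∈ localRing L 𝔓) : τ x ∈ localRing L 𝔓 := by
  obtain ⟨a, s, hs, rfl⟩ := (mem_localRing_iff 𝔓).mp hx
  refine (mem_localRing_iff 𝔓).mpr ⟨τ • a, τ • s, fun h => hs ?_, ?_⟩
  · exact (Submodule.sub_mem_iff_right _ h).mp (hτ s)
  · rw [map_mul, map_inv₀]
    rfl

/-- The action on the local ring of an element of the inertia group. -/
def inertiaHom {τ : L ≃ₐ[K] L} (hτ : τ ∈ 𝔓.asIdeal.inertia (L ≃ₐ[K] L)) :
    localRing L 𝔓 →+* localRing L 𝔓 :=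
  ((τ : L →+* L).comp (localRing L 𝔓).val.toRingHom).codRestrict (localRing L 𝔓)
    fun x => map_mem_localRing hτ x.2

variable [NumberField K] (𝔭 : HeightOneSpectrum (𝓞 K)) (𝔓)

lemma algebraMap_mem_localRing [h : 𝔓.asIdeal.LiesOver 𝔭.asIdeal] {x : K}
    (hx : x ∈ localRing K 𝔭) : algebraMap K L x ∈ localRing L 𝔓 := by
  obtain ⟨a, s, hs, rfl⟩ := (mem_localRing_iff 𝔭).mp hx
  refine (mem_localRing_iff 𝔓).mpr ⟨algebraMap (𝓞 K) (𝓞 L) a, algebraMap (𝓞 K) (𝓞 L) s, ?_, ?_⟩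
  · rwa [h.over] at hs
  · rw [map_mul, map_inv₀, ← IsScalarTower.algebraMap_apply, ← IsScalarTower.algebraMap_apply,
      ← IsScalarTower.algebraMap_apply, ← IsScalarTower.algebraMap_apply]

/-- The map of local rings induced by an extension of number fields. -/
def localRingMap [𝔓.asIdeal.LiesOver 𝔭.asIdeal] : localRing K 𝔭 →+* localRing L 𝔓 :=
  ((algebraMap K L).comp (localRing K 𝔭).val.toRingHom).codRestrict (localRing L 𝔓)
    fun x => algebraMap_mem_localRing 𝔓 𝔭 x.2

end Galois

/-! ### Properness of projective space -/

section Proper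

variable (n : ℕ)

lemma algebraMap_grading_zero_surjective :
    Function.Surjective (algebraMap (ULift.{u} ℤ) (grading.{u} n 0)) := by
  rintro ⟨x, hx⟩
  have h := hx
  rw [grading, MvPolynomial.homogeneousSubmodule_zero, Submodule.mem_one] at h
  obtain ⟨y, hy⟩ := h
  exact ⟨y, Subtype.ext hy⟩

instance : Algebra.FiniteType (grading.{u} n 0) (MvPolynomial (Fin (n + 1)) (ULift.{u} ℤ)) := by
  have : IsScalarTower (ULift.{u} ℤ) (grading.{u} n 0)
      (MvPolynomial (Fin (n + 1)) (ULift.{u} ℤ)) := ⟨fun a b c => smul_mul_assoc a b.1 c⟩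
  exact Algebra.FiniteType.of_restrictScalars_finiteType (ULift.{u} ℤ) _ _

/-- `Proj` is proper over the spectrum of the degree-zero part, which is closed in
$\mathrm{Spec}\,\mathbb{Z}$ because degree-zero polynomials are constants. -/
instance isProper_terminal_from_ProjZ : IsProper (terminal.from (ProjZ.{u} n)) := by
  let g : Spec (.of (grading.{u} n 0)) ⟶ Spec (.of (ULift.{u} ℤ)) :=
    Spec.map (CommRingCat.ofHom (algebraMap (ULift.{u} ℤ) (grading.{u} n 0)))
  have : IsClosedImmersion g :=
    IsClosedImmersion.spec_of_surjective _ (algebraMap_grading_zero_surjective n)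
  let e : Spec (.of (ULift.{u} ℤ)) ≅ ⊤_ Scheme.{u} :=
    specULiftZIsTerminal.uniqueUpToIso terminalIsTerminal
  have h : terminal.from (ProjZ.{u} n) = Proj.toSpecZero (grading.{u} n) ≫ g ≫ e.hom :=
    Subsingleton.elim _ _
  rw [h]
  infer_instance

end Proper

/-! ### Chart coordinates of affine points -/

section Coordinates

variable {n : ℕ}

/-- The value of `X_j / X_i` at an affine point of the chart `X_i ≠ 0`. -/
def affineCoord {R : Type u} [CommRing R] (Q : Spec (.of R) ⟶ ProjZ.{u} n) (i : Fin (n + 1))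
    (hi : ⊤ ≤ Q ⁻¹ᵁ chart i) (j : Fin (n + 1)) : R :=
  (Scheme.ΓSpecIso (.of R)).hom (Q.appLE (chart i) ⊤ hi (ratio i j))

lemma affineCoord_comp {R S : Type u} [CommRing R] [CommRing S] (f : R →+* S)
    (Q : Spec (.of R) ⟶ ProjZ.{u} n) (Q' : Spec (.of S) ⟶ ProjZ.{u} n)
    (hQ : Q' = Spec.map (CommRingCat.ofHom f) ≫ Q) (i : Fin (n + 1))
    (hi : ⊤ ≤ Q ⁻¹ᵁ chart i) (hi' : ⊤ ≤ Q' ⁻¹ᵁ chart i) (j : Fin (n + 1)) :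
    affineCoord Q' i hi' j = f (affineCoord Q i hi j) := by
  subst hQ
  have h : (Spec.map (CommRingCat.ofHom f) ≫ Q).appLE (chart i) ⊤ hi' =
      Q.appLE (chart i) ⊤ hi ≫ (Spec.map (CommRingCat.ofHom f)).appTop := by
    rw [← Scheme.Hom.appLE_comp_appLE _ _ (chart i) ⊤ ⊤ hi le_rfl]
    simp [Scheme.Hom.appTop, Scheme.Hom.app_eq_appLE]
  rw [affineCoord, h, affineCoord]
  have := Scheme.ΓSpecIso_naturality (CommRingCat.ofHom f)
  exact congr($this (Q.appLE (chart i) ⊤ hi (ratio i j)))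

lemma ratio_self (i : Fin (n + 1)) : ratio.{u} i i = 1 := by
  refine Eq.trans (congrArg (Proj.awayToSection (grading.{u} n) (MvPolynomial.X i)).hom ?_)
    (map_one (Proj.awayToSection (grading.{u} n) (MvPolynomial.X i)).hom)
  apply HomogeneousLocalization.val_injective
  rw [HomogeneousLocalization.Away.val_mk, HomogeneousLocalization.val_one]
  simp only [pow_one]
  exact Localization.mk_self (⟨_, Submonoid.mem_powers _⟩ : Submonoid.powers _)

lemma affineCoord_self {R : Type u} [CommRing R] (Q : Spec (.of R) ⟶ ProjZ.{u} n) (i : Fin (n + 1))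
    (hi : ⊤ ≤ Q ⁻¹ᵁ chart i) : affineCoord Q i hi i = 1 := by
  rw [affineCoord, ratio_self]
  simp

lemma ratio_val (i j : Fin (n + 1)) (x : ProjectiveSpectrum (grading.{u} n))
    (hx : MvPolynomial.X i ∉ x.asHomogeneousIdeal) :
    HomogeneousLocalization.val ((ratio.{u} i j).val ⟨x, hx⟩) =
      Localization.mk (MvPolynomial.X j)
        (⟨MvPolynomial.X i, hx⟩ : (x.asHomogeneousIdeal.toIdeal.primeCompl)) := by
  refine (ProjectiveSpectrum.Proj.awayToSection_apply _ _ _ _).trans ?_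
  rw [HomogeneousLocalization.Away.val_mk, Localization.mk_eq_mk', IsLocalization.map_mk',
    ← Localization.mk_eq_mk']
  simp
-- Sections of `Proj` are functions with values in homogeneous localizations, so the cocycle
-- relation is checked point by point on fractions.
lemma ratio_mul_ratio (i k j : Fin (n + 1)) :
    (ProjZ.{u} n).presheaf.map (homOfLE (inf_le_left : chart i ⊓ chart k ≤ chart i)).op
        (ratio i j) *
      (ProjZ.{u} n).presheaf.map (homOfLE (inf_le_right : chart i ⊓ chart k ≤ chart k)).op
        (ratio k i) =
      (ProjZ.{u} n).presheaf.map (homOfLE (inf_le_right : chart i ⊓ chart k ≤ chart k)).op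
        (ratio k j) := by
  apply Subtype.ext
  funext x
  apply HomogeneousLocalization.val_injective
  refine (HomogeneousLocalization.val_mul _ _).trans ?_
  refine (congrArg₂ (· * ·) (ratio_val i j x.1 x.2.1) (ratio_val k i x.1 x.2.2)).trans ?_
  refine Eq.trans ?_ (ratio_val k j x.1 x.2.2).symm
  simp only [Localization.mk_mul, Localization.mk_eq_mk_iff, Localization.r_iff_exists]
  refine ⟨1, ?_⟩
  simp only [OneMemClass.coe_one, one_mul, Submonoid.coe_mul]
  ring

lemma affineCoord_mul {R : Type u} [CommRing R] (Q : Spec (.of R) ⟶ ProjZ.{u} n) (i k : Fin (n + 1))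
    (hi : ⊤ ≤ Q ⁻¹ᵁ chart i) (hk : ⊤ ≤ Q ⁻¹ᵁ chart k) (j : Fin (n + 1)) :
    affineCoord Q i hi j * affineCoord Q k hk i = affineCoord Q k hk j := by
  have hik : ⊤ ≤ Q ⁻¹ᵁ (chart i ⊓ chart k) := le_inf hi hk
  have h1 : Q.appLE (chart i) ⊤ hi = (ProjZ.{u} n).presheaf.map
      (homOfLE (inf_le_left : chart i ⊓ chart k ≤ chart i)).op ≫ Q.appLE _ ⊤ hik := by
    rw [Scheme.Hom.map_appLE]
  have h2 : Q.appLE (chart k) ⊤ hk = (ProjZ.{u} n).presheaf.map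
      (homOfLE (inf_le_right : chart i ⊓ chart k ≤ chart k)).op ≫ Q.appLE _ ⊤ hik := by
    rw [Scheme.Hom.map_appLE]
  rw [affineCoord, affineCoord, affineCoord, h1, h2, ← map_mul]
  congr 1
  simp only [CommRingCat.comp_apply]
  rw [← map_mul, ratio_mul_ratio]

/-- Homogeneous coordinates agree up to a scalar with the coordinates in any chart. -/
lemma exists_homCoords_eq {L : Type u} [Field L] (Q : Spec (.of L) ⟶ ProjZ.{u} n) (i : Fin (n + 1))
    (hi : ⊤ ≤ Q ⁻¹ᵁ chart i) :
    ∃ c : L, c ≠ 0 ∧ ∀ j, homCoords Q j = c * affineCoord Q i hi j := by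
  let k := (exists_chart Q).choose
  have hk : ⊤ ≤ Q ⁻¹ᵁ chart k := (exists_chart Q).choose_spec
  -- The scalar is the value of $X_i/X_k$; it is nonzero because its product with $X_k/X_i$ is $1$.
  refine ⟨affineCoord Q k hk i, fun h => ?_, fun j => ?_⟩
  · have := affineCoord_mul Q i k hi hk k
    rw [h, mul_zero, affineCoord_self] at this
    exact zero_ne_one this
  · rw [mul_comm, affineCoord_mul Q i k hi hk j]
    rfl

/-- Every point of a local spectrum specializes to the closed point, so an open set containing the
latter is everything. -/
lemma top_le_preimage_chart {A : Type u} [CommRing A] [IsLocalRing A] (Q : Spec (.of A) ⟶ ProjZ.{u} n)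
    (i : Fin (n + 1)) (h : Q (IsLocalRing.closedPoint A) ∈ chart i) : ⊤ ≤ Q ⁻¹ᵁ chart i := by
  intro x _
  exact (IsLocalRing.specializes_closedPoint x).mem_open (Q ⁻¹ᵁ chart i).2 h

lemma exists_chart_of_isLocalRing {A : Type u} [CommRing A] [IsLocalRing A]
    (Q : Spec (.of A) ⟶ ProjZ.{u} n) : ∃ i : Fin (n + 1), Q (IsLocalRing.closedPoint A) ∈ chart i :=
  TopologicalSpace.Opens.mem_iSup.mp ((iSup_chart.{u} n).ge (Set.mem_univ _))

end Coordinates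

/-! ### From congruence modulo `p` to distance -/

section Congruence

variable {F : Type u} [Field F] [NumberField F] (v : HeightOneSpectrum (𝓞 F))
  {p : ℕ} [Fact p.Prime]

/-- Integral points of projective space that agree modulo `p` are at logarithmic distance at least
`log p`. -/
lemma log_le_logDist_of_congr {n : ℕ} (hp : (p : 𝓞 F) ∈ v.asIdeal)
    (Q Q' : Spec (.of (localRing F v)) ⟶ ProjZ.{u} n)
    (h : Spec.map (CommRingCat.ofHom (Ideal.Quotient.mk (Ideal.span {(p : localRing F v)}))) ≫ Q =
      Spec.map (CommRingCat.ofHom (Ideal.Quotient.mk (Ideal.span {(p : localRing F v)}))) ≫ Q') :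
    ((Real.log p : ℝ) : EReal) ≤ logDist F v
      (homCoords (Spec.map (CommRingCat.ofHom (algebraMap (localRing F v) F)) ≫ Q))
      (homCoords (Spec.map (CommRingCat.ofHom (algebraMap (localRing F v) F)) ≫ Q')) := by
  let A := localRing F v
  let I : Ideal A := Ideal.span {(p : A)}
  have hI : I ≤ IsLocalRing.maximalIdeal A := by
    rw [Ideal.span_singleton_le_iff_mem]
    exact prime_mem_maximalIdeal v hp
  have : Nontrivial (A ⧸ I) := Ideal.Quotient.nontrivial_iff.mpr fun h => by
    rw [h] at hI
    exact Ideal.IsPrime.ne_top' (top_le_iff.mp hI)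
  have : IsLocalRing (A ⧸ I) := .of_surjective' _ Ideal.Quotient.mk_surjective
  have : IsLocalHom (Ideal.Quotient.mk I) :=
    IsLocalHom.of_surjective _ Ideal.Quotient.mk_surjective
  have hcl : Spec.map (CommRingCat.ofHom (Ideal.Quotient.mk I)) (IsLocalRing.closedPoint (A ⧸ I)) =
      IsLocalRing.closedPoint A :=
    IsLocalRing.comap_closedPoint (Ideal.Quotient.mk I)
  obtain ⟨i, hi⟩ := exists_chart_of_isLocalRing Q
  have hQi := top_le_preimage_chart Q i hi
  -- The closed point of $\mathrm{Spec}\,A$ comes from $\mathrm{Spec}\,A/I$, where `Q` and `Q'`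
  -- agree, so one chart serves both.
  have hQi' : ⊤ ≤ Q' ⁻¹ᵁ chart i := by
    refine top_le_preimage_chart Q' i ?_
    rw [← hcl] at hi ⊢
    exact congr($h (IsLocalRing.closedPoint (A ⧸ I))) ▸ hi
  have hle : ∀ {T : Type u} [CommRing T] (g : A →+* T) (R : Spec (.of A) ⟶ ProjZ.{u} n),
      ⊤ ≤ R ⁻¹ᵁ chart i → ⊤ ≤ (Spec.map (CommRingCat.ofHom g) ≫ R) ⁻¹ᵁ chart i :=
    fun g R hR x _ => hR (Set.mem_univ (Spec.map (CommRingCat.ofHom g) x))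
  have hcongr : ∀ j, Ideal.Quotient.mk I (affineCoord Q i hQi j) =
      Ideal.Quotient.mk I (affineCoord Q' i hQi' j) := by
    intro j
    rw [← affineCoord_comp _ Q _ rfl i hQi (hle _ Q hQi),
      ← affineCoord_comp _ Q' _ h i hQi' (hle _ Q hQi)]
  obtain ⟨c, hc, hcQ⟩ := exists_homCoords_eq _ i (hle (algebraMap A F) Q hQi)
  obtain ⟨d, hd, hdQ⟩ := exists_homCoords_eq _ i (hle (algebraMap A F) Q' hQi')
  refine log_le_logDist v hp (i := i) hc hd hcQ hdQ ?_ ?_ (affineCoord_self _ _ _)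
    (affineCoord_self _ _ _)
  · intro j
    rw [affineCoord_comp (algebraMap A F) Q _ rfl i hQi]
    exact Subtype.prop _
  · intro j
    rw [affineCoord_comp (algebraMap A F) Q _ rfl i hQi,
      affineCoord_comp (algebraMap A F) Q' _ rfl i hQi']
    obtain ⟨t, ht⟩ := Ideal.mem_span_singleton.mp (Ideal.Quotient.eq.mp (hcongr j))
    refine ⟨t, t.2, ?_⟩
    rw [← map_sub, ht, map_mul, map_natCast]
    rfl

end Congruence

/-! ### Frobenius and points of the special fiber -/

section Frobenius

variable {p : ℕ} [Fact p.Prime]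

/-- A morphism to an affine scheme is determined on global functions, where the composite with
Frobenius is $a\mapsto g(a)^p$. -/
lemma absFrob_comp_Spec_map {A R : Type u} [CommRing A] [CommRing R]
    (hR : HasChar p (Spec (.of R))) {g h : A →+* R} (hgh : ∀ a, g a ^ p = h a ^ p) :
    absFrob hR ≫ Spec.map (CommRingCat.ofHom g) = absFrob hR ≫ Spec.map (CommRingCat.ofHom h) := by
  have key : ∀ (g : A →+* R) (a : A), (absFrob hR ≫ Spec.map (CommRingCat.ofHom g)).appTop
      ((Scheme.ΓSpecIso (.of A)).inv a) = (Scheme.ΓSpecIso (.of R)).inv (g a ^ p) := by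
    intro g a
    have h1 := congr($(Scheme.ΓSpecIso_inv_naturality (CommRingCat.ofHom g)) a)
    rw [map_pow]
    exact congrArg (· ^ p) h1.symm
  refine ext_of_isAffine ?_
  rw [← cancel_epi (Scheme.ΓSpecIso (.of A)).inv]
  ext a
  exact (key g a).trans ((congrArg _ (hgh a)).trans (key h a).symm)

lemma relFrob_fst {X S : Scheme.{u}} (f : X ⟶ S) (hS : HasChar p S) :
    relFrob f hS ≫ pullback.fst f (absFrob hS) = absFrob (hS.of_hom f) :=
  pullback.lift_fst _ _ _

lemma relFrob_snd {X S : Scheme.{u}} (f : X ⟶ S) (hS : HasChar p S) :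
    relFrob f hS ≫ pullback.snd f (absFrob hS) = f :=
  pullback.lift_snd _ _ _

variable {K : Type u} [Field K] [NumberField K] {v : HeightOneSpectrum (𝓞 K)}

lemma reduction_fst {Y : Scheme.{u}} (f : Y ⟶ Spec (.of (localRing K v))) (Φ : Y ⟶ Y)
    (hΦ : Φ ≫ f = f) : reduction f Φ hΦ ≫ pullback.fst f (closedPt v) =
      pullback.fst f (closedPt v) ≫ Φ :=
  pullback.lift_fst _ _ _

/-- An endomorphism whose reduction factors through Frobenius identifies points with values in a
ring of characteristic `p` that become equal after composition with Frobenius. -/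
lemma comp_eq_of_factorsThroughFrob (hp : (p : 𝓞 K) ∈ v.asIdeal) {Y : Scheme.{u}}
    (f : Y ⟶ Spec (.of (localRing K v))) (Φ : Y ⟶ Y) (hΦ : Φ ≫ f = f)
    (hFrob : FactorsThroughFrob (specialFiberToBase f) (hasChar_residue v hp) (reduction f Φ hΦ))
    {R : Type u} [CommRing R] (hR : HasChar p (Spec (.of R))) (g : localRing K v →+* R)
    (hg : ∀ x ∈ IsLocalRing.maximalIdeal (localRing K v), g x = 0)
    {a b : Spec (.of R) ⟶ Y} (ha : a ≫ f = Spec.map (CommRingCat.ofHom g))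
    (hb : b ≫ f = Spec.map (CommRingCat.ofHom g)) (hab : absFrob hR ≫ a = absFrob hR ≫ b) :
    a ≫ Φ = b ≫ Φ := by
  obtain ⟨ψ, hψ⟩ := hFrob
  -- The base map factors through the residue field, which lifts `a` and `b` to the special fiber.
  let gbar : localResidue K v →+* R := Ideal.Quotient.lift _ g hg
  have hgbar : Spec.map (CommRingCat.ofHom g) = Spec.map (CommRingCat.ofHom gbar) ≫ closedPt v := by
    rw [← Spec.map_comp]
    rfl
  let a' : Spec (.of R) ⟶ specialFiber f :=
    pullback.lift a (Spec.map (CommRingCat.ofHom gbar)) (ha.trans hgbar)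
  let b' : Spec (.of R) ⟶ specialFiber f :=
    pullback.lift b (Spec.map (CommRingCat.ofHom gbar)) (hb.trans hgbar)
  have ha₁ : a' ≫ pullback.fst f (closedPt v) = a := pullback.lift_fst _ _ _
  have ha₂ : a' ≫ specialFiberToBase f = Spec.map (CommRingCat.ofHom gbar) := pullback.lift_snd _ _ _
  have hb₁ : b' ≫ pullback.fst f (closedPt v) = b := pullback.lift_fst _ _ _
  have hb₂ : b' ≫ specialFiberToBase f = Spec.map (CommRingCat.ofHom gbar) := pullback.lift_snd _ _ _
  have hfrob : a' ≫ relFrob (specialFiberToBase f) (hasChar_residue v hp) =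
      b' ≫ relFrob (specialFiberToBase f) (hasChar_residue v hp) := by
    -- The first projection from the Frobenius twist gives the absolute Frobenius, moved to the
    -- source by naturality; the second gives the structure map.
    refine pullback.hom_ext ?_ ?_
    · rw [Category.assoc, Category.assoc, relFrob_fst, ← absFrob_naturality a' hR,
        ← absFrob_naturality b' hR]
      refine pullback.hom_ext ?_ ?_
      · rw [Category.assoc, Category.assoc, ha₁, hb₁, hab]
      · rw [Category.assoc, Category.assoc, ha₂, hb₂]
    · rw [Category.assoc, Category.assoc, relFrob_snd, ha₂, hb₂]
  have ha' : a' ≫ reduction f Φ hΦ ≫ pullback.fst f (closedPt v) = a ≫ Φ := by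
    rw [reduction_fst, reassoc_of% ha₁]
  have hb' : b' ≫ reduction f Φ hΦ ≫ pullback.fst f (closedPt v) = b ≫ Φ := by
    rw [reduction_fst, reassoc_of% hb₁]
  rw [← ha', ← hb', hψ, Category.assoc, reassoc_of% hfrob]

end Frobenius

end RamDist

end

/-- Here `X ⊆ ℙ^n_K` is a closed subscheme, `Y ⊆ ℙ^n` over `𝓞_{K,𝔭}` is a model of it (its generic
fiber is `X`, compatibly with the embeddings), and `Φ` extends `φ`. -/
theorem mainTheorem7
    {K L : Type u} [Field K] [NumberField K] [Field L] [NumberField L] [Algebra K L]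
    -- a prime `𝔭` of `K` of local degree one over `p`, i.e. with `K_𝔭 = ℚ_p`
    (p : ℕ) [Fact p.Prime] (𝔭 : HeightOneSpectrum (𝓞 K))
    (hp : (p : 𝓞 K) ∈ 𝔭.asIdeal) (hdeg : RamDist.localDegree K 𝔭 = 1)
    -- the variety `X` and its finite `K`-endomorphism `φ`
    {n : ℕ} {X : Scheme.{u}} (i : X ⟶ RamDist.PSpace n (Spec (.of K))) [IsClosedImmersion i]
    (φ : X ⟶ X) [IsFinite φ]
    (hφ : φ ≫ i ≫ RamDist.PSpace.toBase n _ = i ≫ RamDist.PSpace.toBase n _)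
    -- the model and the extension `Φ` of `φ`
    {Y : Scheme.{u}} (ι : Y ⟶ RamDist.PSpace n (Spec (.of (RamDist.localRing K 𝔭))))
    [IsClosedImmersion ι] (j : X ⟶ Y)
    (hmodel : IsPullback j i ι (RamDist.PSpace.map n (RamDist.genericPt 𝔭)))
    (Φ : Y ⟶ Y) [IsFinite Φ]
    (hΦ : Φ ≫ ι ≫ RamDist.PSpace.toBase n _ = ι ≫ RamDist.PSpace.toBase n _)
    (hext : j ≫ Φ = φ ≫ j)
    -- the reduction of `Φ` factors through Frobenius
    (hFrob : RamDist.FactorsThroughFrob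
      (RamDist.specialFiberToBase (ι ≫ RamDist.PSpace.toBase n _))
      (RamDist.hasChar_residue 𝔭 hp) (RamDist.reduction (ι ≫ RamDist.PSpace.toBase n _) Φ hΦ))
    -- `L/K` is abelian and ramified at `𝔭`, and `𝔓` lies over `𝔭`
    [IsAbelianGalois K L]
    (hram : ∃ 𝔔 : HeightOneSpectrum (𝓞 L),
      𝔔.asIdeal.LiesOver 𝔭.asIdeal ∧ 1 < 𝔔.asIdeal.ramificationIdx (𝓞 K))
    (𝔓 : HeightOneSpectrum (𝓞 L)) [𝔓.asIdeal.LiesOver 𝔭.asIdeal]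
    -- the inertia element `τ`
    (τ : L ≃ₐ[K] L) (hτ : τ ∈ 𝔓.asIdeal.inertia (L ≃ₐ[K] L)) (hτ1 : τ ≠ 1)
    (hτp : ∀ α ∈ RamDist.localRing L 𝔓, ∃ c ∈ RamDist.localRing L 𝔓,
      τ α ^ p - α ^ p = (p : L) * c)
    -- a point `P ∈ X(L)`
    (P : Spec (.of L) ⟶ X)
    (hP : P ≫ i ≫ RamDist.PSpace.toBase n _ =
      Spec.map (CommRingCat.ofHom (algebraMap K L))) :
    ((Real.log p : ℝ) : EReal) ≤
      RamDist.logDist L 𝔓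
        (RamDist.homCoords
          ((Spec.map (CommRingCat.ofHom (τ : L →+* L)) ≫ P) ≫ φ ≫ i ≫
            RamDist.PSpace.toProjZ n _))
        (RamDist.homCoords (P ≫ φ ≫ i ≫ RamDist.PSpace.toProjZ n _)) := by
  have hpP : (p : 𝓞 L) ∈ 𝔓.asIdeal := by
    have := (Ideal.mem_of_liesOver 𝔓.asIdeal 𝔭.asIdeal (p : 𝓞 K)).mp hp
    simpa using this
  let gen : Spec (.of L) ⟶ Spec (.of (RamDist.localRing L 𝔓)) :=
    Spec.map (CommRingCat.ofHom (algebraMap (RamDist.localRing L 𝔓) L))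
  let s : Spec (.of (RamDist.localRing L 𝔓)) ⟶ Spec (.of (RamDist.localRing K 𝔭)) :=
    Spec.map (CommRingCat.ofHom (RamDist.localRingMap 𝔓 𝔭))
  let σ : Spec (.of (RamDist.localRing L 𝔓)) ⟶ Spec (.of (RamDist.localRing L 𝔓)) :=
    Spec.map (CommRingCat.ofHom (RamDist.inertiaHom hτ))
  have hsq : (P ≫ j) ≫ ι ≫ RamDist.PSpace.toBase n _ = gen ≫ s := by
    have h1 : RamDist.PSpace.map n (RamDist.genericPt 𝔭) ≫ RamDist.PSpace.toBase n _ =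
        RamDist.PSpace.toBase n _ ≫ RamDist.genericPt 𝔭 := pullback.lift_fst _ _ _
    rw [Category.assoc, ← Category.assoc j, hmodel.w, Category.assoc, h1, reassoc_of% hP]
    simp only [gen, s, ← Spec.map_comp]
    rfl
  have hproper : IsProper (ι ≫ RamDist.PSpace.toBase n _) := inferInstance
  -- Existence in the valuative criterion extends $P$ to an integral point `l` of the model.
  obtain ⟨⟨⟨l, hl₁, hl₂⟩⟩⟩ := (IsProper.eq_valuativeCriterion ▸ hproper :
    (ValuativeCriterion ⊓ @QuasiCompact ⊓ @QuasiSeparated ⊓ @LocallyOfFiniteType)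
      (ι ≫ RamDist.PSpace.toBase n _)).1.1.1.existence
    { R := RamDist.localRing L 𝔓, K := L, i₁ := P ≫ j, i₂ := s, commSq := ⟨hsq⟩ }
  dsimp only at hl₁ hl₂
  -- As $\tau$ fixes $K$, both `l` and `σ ≫ l` are points over the same base map.
  have hσs : σ ≫ s = s := by
    simp only [σ, s, ← Spec.map_comp, ← CommRingCat.ofHom_comp]
    congr 2
    ext x
    exact τ.commutes x
  have hgenσ : gen ≫ σ = Spec.map (CommRingCat.ofHom (τ : L →+* L)) ≫ gen := by
    simp only [σ, gen, ← Spec.map_comp]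
    rfl
  let q := Ideal.Quotient.mk (Ideal.span {(p : RamDist.localRing L 𝔓)})
  have hq : (p : RamDist.localRing L 𝔓 ⧸ Ideal.span {(p : RamDist.localRing L 𝔓)}) = 0 := by
    rw [← map_natCast q]
    exact Ideal.Quotient.eq_zero_iff_mem.mpr (Ideal.mem_span_singleton_self _)
  have hR := RamDist.hasChar_Spec hq
  have hmod : (Spec.map (CommRingCat.ofHom q) ≫ σ ≫ l) ≫ Φ =
      (Spec.map (CommRingCat.ofHom q) ≫ l) ≫ Φ := by
    refine RamDist.comp_eq_of_factorsThroughFrob hp _ Φ hΦ hFrob hR (q.comp (RamDist.localRingMap 𝔓 𝔭))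
      ?_ ?_ ?_ ?_
    · intro x hx
      rw [RamDist.maximalIdeal_eq_span 𝔭 hp hdeg] at hx
      obtain ⟨y, rfl⟩ := Ideal.mem_span_singleton.mp hx
      rw [map_mul, map_natCast, hq, zero_mul]
    · simp only [Category.assoc]
      rw [hl₂, hσs, ← Spec.map_comp]
      rfl
    · simp only [Category.assoc]
      rw [hl₂, ← Spec.map_comp]
      rfl
    · have : RamDist.absFrob hR ≫ Spec.map (CommRingCat.ofHom (q.comp (RamDist.inertiaHom hτ))) =
          RamDist.absFrob hR ≫ Spec.map (CommRingCat.ofHom q) := by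
        refine RamDist.absFrob_comp_Spec_map hR fun x => ?_
        obtain ⟨c, hc, hxc⟩ := hτp x x.2
        refine Eq.trans (map_pow q _ p).symm (Eq.trans ?_ (map_pow q x p))
        refine Ideal.Quotient.eq.mpr ?_
        exact Ideal.mem_span_singleton.mpr ⟨⟨c, hc⟩, Subtype.ext hxc⟩
      rw [CommRingCat.ofHom_comp, Spec.map_comp] at this
      simpa only [Category.assoc] using congr($this ≫ l)
  have hgenl : gen ≫ l ≫ Φ ≫ ι ≫ RamDist.PSpace.toProjZ n _ =
      P ≫ φ ≫ i ≫ RamDist.PSpace.toProjZ n _ := by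
    have h1 : RamDist.PSpace.map n (RamDist.genericPt 𝔭) ≫ RamDist.PSpace.toProjZ n _ =
        RamDist.PSpace.toProjZ n _ :=
      pullback.lift_snd _ _ _
    rw [reassoc_of% hl₁, reassoc_of% hext, ← Category.assoc j, hmodel.w, Category.assoc, h1]
  -- The generic fibers of these two integral points are $\phi(\tau(P))$ and $\phi(P)$, by `hgenσ`
  -- and `hgenl`.
  have hmain := RamDist.log_le_logDist_of_congr 𝔓 hpP (σ ≫ l ≫ Φ ≫ ι ≫ RamDist.PSpace.toProjZ n _)
    (l ≫ Φ ≫ ι ≫ RamDist.PSpace.toProjZ n _) (by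
      simpa only [Category.assoc] using congr($hmod ≫ ι ≫ RamDist.PSpace.toProjZ n _))
  rwa [reassoc_of% hgenσ, hgenl, ← Category.assoc] at hmain
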